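/- Let $n \ge 3$. Let $\mathbb{S}^{n-1}$ be the unit sphere of $\mathbb{R}^n$ with its round metric $d\sigma^2$, and let $d(x,y)=\arccos\langle x,y\rangle$ be the associated distance. Identify the universal cover $\widetilde{Ein}_{1,n-1}$ of the Einstein universe with $\mathbb{S}^{n-1}\times\mathbb{R}$, equipped with the conformal class of the Lorentzian metric $d\sigma^2-dt^2$ and the time orientation for which $\partial_t$ is future-directed. A future-directed causal curve is a piecewise $C^1$ curve whose tangent vectors are all timelike or lightlike and future-directed; a causal curve is a future-directed causal curve or one run backwards. A subset $\Omega$ is causally convex if, for all $p,q\in\Omega$, every causal curve of $\mathbb{S}^{n-1}\times\mathbb{R}$ joining $p$ to $q$ is contained in $\Omega$. A function $f:U\to\overline{\mathbb{R}}=[-\infty,+\infty]$ on a subset $U\subset\mathbb{S}^{n-1}$ is called $1$-Lipschitz if $f(x)\le f(y)+d(x,y)$ for all $x,y\in U$ (so, if $U\neq\emptyset$, $f$ is either real-valued and $1$-Lipschitz in the usual sense, or constant equal to $+\infty$, or constant equal to $-\infty$). Then a subset $\Omega\subset\mathbb{S}^{n-1}\times\mathbb{R}$ is open and causally convex if and only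 if there exist an open subset $U$ of $\mathbb{S}^{n-1}$ and two $1$-Lipschitz functions $f^-,f^+:U\to\overline{\mathbb{R}}$ such that 1. $f^-<f^+$ on $U$; 2. the continuous extensions of $f^-$ and $f^+$ to $\partial U$ coincide, i.e. for every $x\in\partial U$ the limits of $f^-(y)$ and of $f^+(y)$ as $y\to x$, $y\in U$, exist in $\overline{\mathbb{R}}$ and are equal; 3. $\Omega=\{(x,t): x\in U,\ f^-(x)<t<f^+(x)\}$. -/

import Mathlib

open Set Filter Topology

/-- The unit sphere `S^{n-1}` of the Euclidean space `ℝ^n`. -/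
abbrev UnitSph (n : ℕ) : Type := Metric.sphere (0 : EuclideanSpace ℝ (Fin n)) 1

/-- The universal Einstein universe of dimension `n` in a spatio-temporal decomposition, as the
manifold `S^{n-1} × ℝ`.  Its conformal class is that of the Lorentzian metric `dσ² - dt²`, which
enters through `lorentzForm` below. -/
abbrev EinUniv (n : ℕ) : Type := UnitSph n × ℝ

/-- The embedding of `S^{n-1} × ℝ` in `ℝ^n × ℝ`.  Tangent vectors of `S^{n-1} × ℝ` are regarded
as vectors of `ℝ^n × ℝ` through it. -/
def einEmb (n : ℕ) (p : EinUniv n) : EuclideanSpace ℝ (Fin n) × ℝ :=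
  ((p.1 : EuclideanSpace ℝ (Fin n)), p.2)

/-- The quadratic form of the metric `dσ² - dt²`: the round metric `dσ²` is the one induced on the
sphere by the Euclidean metric of `ℝ^n`. -/
noncomputable def lorentzForm {n : ℕ} (v : EuclideanSpace ℝ (Fin n) × ℝ) : ℝ :=
  ‖v.1‖ ^ 2 - v.2 ^ 2

/-- Future-directed causal (timelike or lightlike) vectors; the time orientation is the one for
which `∂/∂t` is future-directed. -/
def IsFutureCausalVec {n : ℕ} (v : EuclideanSpace ℝ (Fin n) × ℝ) : Prop :=
  v ≠ 0 ∧ lorentzForm v ≤ 0 ∧ 0 < v.2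

/-- `γ`, restricted to `[a, b]` with `a < b`, is a `C¹` curve all of whose tangent vectors
(one-sided at the end points) are future-directed causal. -/
def IsFutureCausalArc {n : ℕ} (γ : ℝ → EinUniv n) (a b : ℝ) : Prop :=
  a < b ∧ ContDiffOn ℝ 1 (fun τ => einEmb n (γ τ)) (Icc a b) ∧
    ∀ τ ∈ Icc a b, IsFutureCausalVec (derivWithin (fun τ => einEmb n (γ τ)) (Icc a b) τ)

/-- `γ`, restricted to `[a, b]`, is a (piecewise `C¹`) future-directed causal curve: a finite
concatenation of future-directed causal `C¹` arcs. -/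
inductive IsFutureCausalCurve {n : ℕ} (γ : ℝ → EinUniv n) : ℝ → ℝ → Prop
  | arc {a b : ℝ} : IsFutureCausalArc γ a b → IsFutureCausalCurve γ a b
  | concat {a b c : ℝ} : IsFutureCausalCurve γ a b → IsFutureCausalCurve γ b c →
      IsFutureCausalCurve γ a c

/-- `Ω` is causally convex: for all `p, q ∈ Ω`, every causal curve joining `p` to `q` is contained
in `Ω`.  A past-directed causal curve from `p` to `q` is a future-directed one from `q` to `p` run
backwards, so future-directed curves are enough. -/
def CausallyConvex {n : ℕ} (Ω : Set (EinUniv n)) : Prop :=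
  ∀ p ∈ Ω, ∀ q ∈ Ω, ∀ (γ : ℝ → EinUniv n) (a b : ℝ),
    IsFutureCausalCurve γ a b → γ a = p → γ b = q → ∀ τ ∈ Icc a b, γ τ ∈ Ω

/-- The distance on the unit sphere induced by the round metric: the length
`arccos ⟪x, y⟫ ∈ [0, π]` of the shortest great-circle arc from `x` to `y`. -/
noncomputable def roundDist {n : ℕ} (x y : UnitSph n) : ℝ :=
  InnerProductGeometry.angle (x : EuclideanSpace ℝ (Fin n)) (y : EuclideanSpace ℝ (Fin n))

/-- `f : U → [-∞, +∞]` is `1`-Lipschitz for the round distance: `f x ≤ f y + d(x, y)` on `U`.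
If `U` is non-empty, then `f` is either real-valued and `1`-Lipschitz in the usual sense, or
constant equal to `+∞`, or constant equal to `-∞`.  Values of `f` outside `U` play no role. -/
def IsOneLipschitzOn {n : ℕ} (f : UnitSph n → EReal) (U : Set (UnitSph n)) : Prop :=
  ∀ x ∈ U, ∀ y ∈ U, f x ≤ f y + ((roundDist x y : ℝ) : EReal)

/-- The continuous extensions of `f|U` and `g|U` to `∂U` exist and coincide: at each point of the
boundary of `U`, both functions have the same limit in `[-∞, +∞]` along `U`. -/
def BoundaryExtensionsCoincide {n : ℕ} (f g : UnitSph n → EReal) (U : Set (UnitSph n)) : Prop :=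
  ∀ x ∈ frontier U, ∃ l : EReal, Tendsto f (𝓝[U] x) (𝓝 l) ∧ Tendsto g (𝓝[U] x) (𝓝 l)

/-! A future-directed causal curve is one whose speed on the sphere is at most its speed in time,
and great circles realise the round distance; hence the future-directed causal curves issuing
from `(x, s)` reach exactly the points `(y, t)` with `d(x, y) ≤ t - s` (and `(y, t) ≠ (x, s)`).
Causal convexity thus becomes convexity for this order, and a function is `1`-Lipschitz exactly
when its strict epigraph is a future set, or equivalently its strict hypograph a past set. An
open causally convex set is therefore the region between its lower and upper boundaries, both
`1`-Lipschitz. If these had different limits at a point `x ∈ ∂U`, a point over `x` strictly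
between the two limits would lie in the past and in the future of points of `Ω`, forcing `x ∈
U`. Conversely, a causal curve between two points of a region stays between the (extended)
graphs, so it can only leave the region over a point of `∂U`, where there is no room between
them. -/

section AnglesAndArcs

open InnerProductGeometry

theorem hasDerivWithinAt_norm_of_eq_zero {E : Type*} [NormedAddCommGroup E] [NormedSpace ℝ E]
    {f : ℝ → E} {f' : E} {x : ℝ} (hf : HasDerivWithinAt f f' (Ici x) x) (hx : f x = 0) :
    HasDerivWithinAt (fun τ => ‖f τ‖) ‖f'‖ (Ici x) x := by
  rw [← hasDerivWithinAt_Ioi_iff_Ici, hasDerivWithinAt_iff_tendsto_slope' self_notMem_Ioi] at hf ⊢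
  refine hf.norm.congr' ?_
  filter_upwards [self_mem_nhdsWithin] with z hz
  have hz : 0 < z - x := sub_pos.2 hz
  simp [slope_def_module, norm_smul, hx, abs_of_pos hz]

variable {V : Type*} [NormedAddCommGroup V] [InnerProductSpace ℝ V]

theorem norm_sub_eq_two_mul_sin_half_angle {x y : V} (hx : ‖x‖ = 1) (hy : ‖y‖ = 1) :
    ‖y - x‖ = 2 * Real.sin (angle x y / 2) := by
  have hsin : 0 ≤ Real.sin (angle x y / 2) :=
    Real.sin_nonneg_of_nonneg_of_le_pi (by linarith [angle_nonneg x y])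
      (by linarith [angle_nonneg x y, angle_le_pi x y])
  rw [← sq_eq_sq₀ (norm_nonneg _) (by positivity), norm_sub_sq_real, hx, hy, real_inner_comm,
    inner_eq_cos_angle_of_norm_eq_one hx hy, mul_pow, Real.sin_sq_eq_half_sub,
    mul_div_cancel₀ _ (two_ne_zero' ℝ)]
  ring

theorem angle_eq_two_mul_arcsin_half_norm_sub {x y : V} (hx : ‖x‖ = 1) (hy : ‖y‖ = 1) :
    angle x y = 2 * Real.arcsin (‖y - x‖ / 2) := by
  rw [norm_sub_eq_two_mul_sin_half_angle hx hy, mul_div_cancel_left₀ _ (two_ne_zero' ℝ),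
    Real.arcsin_sin (by linarith [angle_nonneg x y, Real.pi_pos]) (by linarith [angle_le_pi x y])]
  ring

theorem hasDerivWithinAt_angle_of_norm_eq_one {c : ℝ → V} {c' : V} {x : ℝ}
    (hc : HasDerivWithinAt c c' (Ici x) x) (hnorm : ∀ᶠ τ in 𝓝[≥] x, ‖c τ‖ = 1) :
    HasDerivWithinAt (fun τ => angle (c x) (c τ)) ‖c'‖ (Ici x) x := by
  have hx : ‖c x‖ = 1 := hnorm.self_of_nhdsWithin self_mem_Ici
  have hchord : HasDerivWithinAt (fun τ => ‖c τ - c x‖) ‖c'‖ (Ici x) x :=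
    hasDerivWithinAt_norm_of_eq_zero (hc.sub_const _) (sub_self _)
  have harcsin : HasDerivAt (fun u : ℝ => 2 * Real.arcsin (u / 2)) 1 ‖c x - c x‖ := by
    have h : HasDerivAt Real.arcsin 1 ((0 : ℝ) / 2) := by
      simpa using Real.hasDerivAt_arcsin (x := 0) (by norm_num) (by norm_num)
    simpa [Function.comp_def] using
      (h.comp 0 ((hasDerivAt_id (0 : ℝ)).div_const 2)).const_mul 2
  have h := harcsin.comp_hasDerivWithinAt x hchord
  rw [one_mul] at h
  exact h.congr_of_eventuallyEq_of_mem
    (hnorm.mono fun τ hτ => angle_eq_two_mul_arcsin_half_norm_sub hx hτ) self_mem_Ici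

theorem angle_le_sub_of_norm_deriv_right_le {c c' : ℝ → V} {T T' : ℝ → ℝ} {a b : ℝ} (hab : a ≤ b)
    (hnorm : ∀ τ ∈ Icc a b, ‖c τ‖ = 1)
    (hc : ContinuousOn c (Icc a b)) (hT : ContinuousOn T (Icc a b))
    (hc' : ∀ τ ∈ Ico a b, HasDerivWithinAt c (c' τ) (Ici τ) τ)
    (hT' : ∀ τ ∈ Ico a b, HasDerivWithinAt T (T' τ) (Ici τ) τ)
    (hle : ∀ τ ∈ Ico a b, ‖c' τ‖ ≤ T' τ) : angle (c a) (c b) ≤ T b - T a := by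
  have hne : ∀ τ ∈ Icc a b, c τ ≠ 0 := fun τ hτ h => by simpa [h] using hnorm τ hτ
  have ha : a ∈ Icc a b := left_mem_Icc.2 hab
  have hangle : ContinuousOn (fun τ => angle (c a) (c τ)) (Icc a b) := fun τ hτ =>
    (continuousAt_angle (x := (c a, c τ)) (hne a ha) (hne τ hτ)).comp_continuousWithinAt
      (f := fun τ => (c a, c τ)) (continuousWithinAt_const.prodMk (hc τ hτ))
  refine image_le_of_liminf_slope_right_le_deriv_boundary (B := fun τ => T τ - T a) hangle ?_
    (hT.sub continuousOn_const) (fun τ hτ => (hT' τ hτ).sub_const _) (fun τ hτ r hr => ?_)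
    (right_mem_Icc.2 hab)
  · simp [angle_self (hne a ha)]
  have hderiv : HasDerivWithinAt (fun z => angle (c τ) (c z)) ‖c' τ‖ (Ioi τ) τ :=
    (hasDerivWithinAt_angle_of_norm_eq_one (hc' τ hτ) (eventually_of_mem
      (Icc_mem_nhdsGE_of_mem hτ) hnorm)).Ioi_of_Ici
  refine Eventually.frequently ?_
  filter_upwards [((hasDerivWithinAt_iff_tendsto_slope' self_notMem_Ioi).1
    hderiv).eventually_lt_const ((hle τ hτ).trans_lt hr), self_mem_nhdsWithin] with z hz hτz
  refine lt_of_le_of_lt ?_ hz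
  rw [slope_def_field, slope_def_field, angle_self (hne τ (Ico_subset_Icc_self hτ))]
  have := angle_le_angle_add_angle (c a) (c τ) (c z)
  exact div_le_div_of_nonneg_right (by linarith) (sub_pos.2 hτz).le

/-- The great circle issuing from the unit vector `x` with unit velocity `v` orthogonal to `x`,
parametrised by arc length. -/
noncomputable def greatCircle (x v : V) (θ : ℝ) : V :=
  Real.cos θ • x + Real.sin θ • v

theorem greatCircle_zero (x v : V) : greatCircle x v 0 = x := by
  simp [greatCircle]

theorem norm_greatCircle {x v : V} (hx : ‖x‖ = 1) (hv : ‖v‖ = 1) (hxv : inner ℝ x v = 0) (θ : ℝ) :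
    ‖greatCircle x v θ‖ = 1 := by
  rw [← sq_eq_sq₀ (norm_nonneg _) zero_le_one, greatCircle, norm_add_sq_real, norm_smul, norm_smul,
    inner_smul_left, inner_smul_right, hxv, hx, hv]
  simp

theorem hasDerivAt_greatCircle (x v : V) (θ : ℝ) :
    HasDerivAt (greatCircle x v) (greatCircle v (-x) θ) θ := by
  refine (((Real.hasDerivAt_cos θ).smul_const x).add
    ((Real.hasDerivAt_sin θ).smul_const v)).congr_deriv ?_
  rw [greatCircle, smul_neg, neg_smul, add_comm]

theorem contDiff_greatCircle {k : WithTop ℕ∞} (x v : V) : ContDiff ℝ k (greatCircle x v) := by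
  unfold greatCircle
  fun_prop

theorem exists_norm_eq_one_and_inner_eq_zero (hV : 1 < Module.rank ℝ V) (x : V) :
    ∃ v : V, ‖v‖ = 1 ∧ inner ℝ x v = 0 := by
  have hne : (ℝ ∙ x)ᗮ ≠ ⊥ := by
    rw [Ne, Submodule.orthogonal_eq_bot_iff]
    intro htop
    exact hV.not_ge ((rank_top ℝ V).symm.trans_le (htop ▸ rank_span_le {x} |>.trans (by simp)))
  have := Submodule.nontrivial_iff_ne_bot.2 hne
  obtain ⟨v, hv⟩ := exists_norm_eq (ℝ ∙ x)ᗮ zero_le_one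
  exact ⟨v, hv, Submodule.mem_orthogonal_singleton_iff_inner_right.1 v.2⟩

theorem exists_greatCircle_angle_eq (hV : 1 < Module.rank ℝ V) {x y : V} (hx : ‖x‖ = 1)
    (hy : ‖y‖ = 1) :
    ∃ v : V, ‖v‖ = 1 ∧ inner ℝ x v = 0 ∧ greatCircle x v (angle x y) = y := by
  have hxy : inner ℝ x y = Real.cos (angle x y) := inner_eq_cos_angle_of_norm_eq_one hx hy
  set w := y - Real.cos (angle x y) • x with hw
  have hyw : Real.cos (angle x y) • x + w = y := add_sub_cancel _ _
  have hxw : inner ℝ x w = 0 := by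
    rw [hw, inner_sub_right, inner_smul_right, real_inner_self_eq_norm_sq, hx, hxy]
    ring
  have hnorm : ‖w‖ = Real.sin (angle x y) := by
    rw [← sq_eq_sq₀ (norm_nonneg _) (sin_angle_nonneg x y), hw, norm_sub_sq_real, norm_smul,
      inner_smul_right, real_inner_comm, hxy, hx, hy, Real.sin_sq, Real.norm_eq_abs, mul_one,
      sq_abs]
    ring
  rcases eq_or_ne w 0 with h0 | h0
  · -- `y = ±x`, and every great circle through `x` passes through `y`.
    obtain ⟨v, hv, hxv⟩ := exists_norm_eq_one_and_inner_eq_zero hV x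
    refine ⟨v, hv, hxv, ?_⟩
    rw [greatCircle, ← hnorm, h0, norm_zero, zero_smul, ← h0, hyw]
  · refine ⟨‖w‖⁻¹ • w, norm_smul_inv_norm h0, ?_, ?_⟩
    · rw [inner_smul_right, hxw, mul_zero]
    · rw [greatCircle, ← hnorm, smul_inv_smul₀ (norm_ne_zero_iff.2 h0), hyw]

end AnglesAndArcs

section RoundDistance

variable {n : ℕ}

theorem UnitSph.norm_coe (x : UnitSph n) : ‖(x : EuclideanSpace ℝ (Fin n))‖ = 1 :=
  norm_eq_of_mem_sphere x

theorem UnitSph.coe_ne_zero (x : UnitSph n) : (x : EuclideanSpace ℝ (Fin n)) ≠ 0 :=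
  ne_zero_of_mem_unit_sphere x

theorem roundDist_self (x : UnitSph n) : roundDist x x = 0 :=
  InnerProductGeometry.angle_self x.coe_ne_zero

theorem roundDist_comm (x y : UnitSph n) : roundDist x y = roundDist y x :=
  InnerProductGeometry.angle_comm _ _

theorem roundDist_nonneg (x y : UnitSph n) : 0 ≤ roundDist x y :=
  InnerProductGeometry.angle_nonneg _ _

theorem roundDist_triangle (x y z : UnitSph n) :
    roundDist x z ≤ roundDist x y + roundDist y z :=
  InnerProductGeometry.angle_le_angle_add_angle _ _ _

theorem eq_of_roundDist_eq_zero {x y : UnitSph n} (h : roundDist x y = 0) : x = y := by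
  rw [roundDist, angle_eq_two_mul_arcsin_half_norm_sub x.norm_coe y.norm_coe] at h
  have hnorm : ‖(y : EuclideanSpace ℝ (Fin n)) - x‖ = 0 := by simpa using h
  exact Subtype.ext (sub_eq_zero.1 (norm_eq_zero.1 hnorm)).symm

theorem continuous_roundDist_left (x : UnitSph n) : Continuous (roundDist x) :=
  continuous_iff_continuousAt.2 fun y =>
    (InnerProductGeometry.continuousAt_angle (x := ((x : EuclideanSpace ℝ (Fin n)), y.1))
      x.coe_ne_zero y.coe_ne_zero).comp (f := fun z : UnitSph n => (x.1, z.1)) (by fun_prop)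

theorem eventually_roundDist_lt (x : UnitSph n) {ε : ℝ} (hε : 0 < ε) :
    ∀ᶠ y in 𝓝 x, roundDist x y < ε :=
  ((continuous_roundDist_left x).tendsto x).eventually_lt_const (by rwa [roundDist_self])

end RoundDistance

section CausalOrder

variable {n : ℕ} {γ : ℝ → EinUniv n} {a b c : ℝ} {p q : EinUniv n}

/-- The causal order of `S^{n-1} × ℝ`: the point `q` lies in the causal future of `p`. It is encoded
by the inequality `d(x, y) ≤ t - s` between `p = (x, s)` and `q = (y, t)` rather than by the
existence of a causal curve, and it is reflexive. -/
def CausallyPrecedes (p q : EinUniv n) : Prop :=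
  roundDist p.1 q.1 ≤ q.2 - p.2

theorem causallyPrecedes_mk_mk_left_iff {x : UnitSph n} {s t : ℝ} :
    CausallyPrecedes (x, s) (x, t) ↔ s ≤ t := by
  rw [CausallyPrecedes, roundDist_self, sub_nonneg]

theorem CausallyPrecedes.trans {m : EinUniv n} (hpm : CausallyPrecedes p m)
    (hmq : CausallyPrecedes m q) : CausallyPrecedes p q := by
  unfold CausallyPrecedes at *
  linarith [roundDist_triangle p.1 m.1 q.1]

theorem CausallyPrecedes.eq_or_lt (h : CausallyPrecedes p q) : p = q ∨ p.2 < q.2 := by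
  rcases (sub_nonneg.1 ((roundDist_nonneg _ _).trans h)).eq_or_lt with heq | hlt
  · rw [CausallyPrecedes, heq, sub_self] at h
    exact .inl (Prod.ext (eq_of_roundDist_eq_zero (h.antisymm (roundDist_nonneg _ _))) heq)
  · exact .inr hlt

theorem continuousOn_of_einEmb {s : Set ℝ} (h : ContinuousOn (fun τ => einEmb n (γ τ)) s) :
    ContinuousOn γ s :=
  (Topology.IsEmbedding.subtypeVal.continuousOn_iff.2 h.fst).prodMk h.snd

theorem IsFutureCausalVec.norm_fst_le {v : EuclideanSpace ℝ (Fin n) × ℝ}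
    (hv : IsFutureCausalVec v) : ‖v.1‖ ≤ v.2 :=
  (sq_le_sq₀ (norm_nonneg _) hv.2.2.le).1 (sub_nonpos.1 hv.2.1)

theorem IsFutureCausalArc.causallyPrecedes (h : IsFutureCausalArc γ a b) {σ τ : ℝ} (hσ : a ≤ σ)
    (hστ : σ ≤ τ) (hτ : τ ≤ b) : CausallyPrecedes (γ σ) (γ τ) := by
  obtain ⟨-, hdiff, hcausal⟩ := h
  set v := derivWithin (fun τ => einEmb n (γ τ)) (Icc a b)
  have hsub : Icc σ τ ⊆ Icc a b := Icc_subset_Icc hσ hτ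
  have hcont : ContinuousOn (fun τ => einEmb n (γ τ)) (Icc σ τ) := hdiff.continuousOn.mono hsub
  have hderiv : ∀ u ∈ Ico σ τ, HasDerivWithinAt (fun τ => einEmb n (γ τ)) (v u) (Ici u) u :=
    fun u hu => (hdiff.differentiableOn one_ne_zero u
      (hsub (Ico_subset_Icc_self hu))).hasDerivWithinAt.mono_of_mem_nhdsWithin
        (Icc_mem_nhdsGE_of_mem ⟨hσ.trans hu.1, hu.2.trans_le hτ⟩)
  have hderiv_fst : ∀ u ∈ Ico σ τ,
      HasDerivWithinAt (fun τ => ((γ τ).1 : EuclideanSpace ℝ (Fin n))) (v u).1 (Ici u) u :=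
    fun u hu => (hderiv u hu).hasFDerivWithinAt.fst.hasDerivWithinAt.congr_deriv (by simp)
  have hderiv_snd : ∀ u ∈ Ico σ τ, HasDerivWithinAt (fun τ => (γ τ).2) (v u).2 (Ici u) u :=
    fun u hu => (hderiv u hu).hasFDerivWithinAt.snd.hasDerivWithinAt.congr_deriv (by simp)
  exact angle_le_sub_of_norm_deriv_right_le (c := fun τ => ((γ τ).1 : EuclideanSpace ℝ (Fin n)))
    (T := fun τ => (γ τ).2) hστ (fun u _ => (γ u).1.norm_coe) hcont.fst hcont.snd
    hderiv_fst hderiv_snd fun u hu => (hcausal u (hsub (Ico_subset_Icc_self hu))).norm_fst_le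

theorem IsFutureCausalCurve.lt (h : IsFutureCausalCurve γ a b) : a < b := by
  induction h with
  | arc h => exact h.1
  | concat _ _ hab hbc => exact hab.trans hbc

theorem IsFutureCausalCurve.continuousOn (h : IsFutureCausalCurve γ a b) :
    ContinuousOn γ (Icc a b) := by
  induction h with
  | arc h => exact continuousOn_of_einEmb h.2.1.continuousOn
  | concat hab hbc ihab ihbc =>
    rw [← Icc_union_Icc_eq_Icc hab.lt.le hbc.lt.le]
    exact ihab.union_of_isClosed ihbc isClosed_Icc isClosed_Icc

theorem IsFutureCausalCurve.causallyPrecedes (h : IsFutureCausalCurve γ a b) {σ τ : ℝ}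
    (hσ : a ≤ σ) (hστ : σ ≤ τ) (hτ : τ ≤ b) : CausallyPrecedes (γ σ) (γ τ) := by
  induction h generalizing σ τ with
  | arc h => exact h.causallyPrecedes hσ hστ hτ
  | @concat _ b _ _ _ ihab ihbc =>
    rcases le_total τ b with hτb | hbτ
    · exact ihab hσ hστ hτb
    rcases le_total b σ with hbσ | hσb
    · exact ihbc hbσ hστ hτ
    · exact (ihab hσ hσb le_rfl).trans (ihbc le_rfl hbτ hτ)

theorem IsFutureCausalArc.congr {γ' : ℝ → EinUniv n} (h : IsFutureCausalArc γ a b)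
    (hγ : EqOn γ' γ (Icc a b)) : IsFutureCausalArc γ' a b := by
  have hemb : EqOn (fun τ => einEmb n (γ' τ)) (fun τ => einEmb n (γ τ)) (Icc a b) :=
    fun τ hτ => congrArg (einEmb n) (hγ hτ)
  refine ⟨h.1, h.2.1.congr hemb, fun τ hτ => ?_⟩
  rw [derivWithin_congr hemb (hemb hτ)]
  exact h.2.2 τ hτ

theorem IsFutureCausalArc.exists_concat {γ₁ γ₂ : ℝ → EinUniv n} (h₁ : IsFutureCausalArc γ₁ a b)
    (h₂ : IsFutureCausalArc γ₂ b c) (hb : γ₁ b = γ₂ b) :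
    ∃ γ, IsFutureCausalCurve γ a c ∧ EqOn γ γ₁ (Icc a b) ∧ EqOn γ γ₂ (Icc b c) := by
  have heq₁ : EqOn (fun τ => if τ ≤ b then γ₁ τ else γ₂ τ) γ₁ (Icc a b) :=
    fun τ hτ => if_pos hτ.2
  have heq₂ : EqOn (fun τ => if τ ≤ b then γ₁ τ else γ₂ τ) γ₂ (Icc b c) := by
    intro τ hτ
    rcases hτ.1.eq_or_lt with rfl | hlt
    · exact (if_pos le_rfl).trans hb
    · exact if_neg hlt.not_ge
  exact ⟨_, .concat (.arc (h₁.congr heq₁)) (.arc (h₂.congr heq₂)), heq₁, heq₂⟩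

theorem isFutureCausalArc_mk_of_norm_deriv_le_one {x : ℝ → UnitSph n}
    {x' : ℝ → EuclideanSpace ℝ (Fin n)} (hab : a < b)
    (hx : ContDiffOn ℝ 1 (fun τ => (x τ : EuclideanSpace ℝ (Fin n))) (Icc a b))
    (hx' : ∀ τ ∈ Icc a b,
      HasDerivWithinAt (fun τ => (x τ : EuclideanSpace ℝ (Fin n))) (x' τ) (Icc a b) τ)
    (hle : ∀ τ ∈ Icc a b, ‖x' τ‖ ≤ 1) : IsFutureCausalArc (fun τ => (x τ, τ)) a b := by
  refine ⟨hab, hx.prodMk contDiffOn_id, fun τ hτ => ?_⟩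
  have hderiv : HasDerivWithinAt (fun τ => einEmb n (x τ, τ)) (x' τ, 1) (Icc a b) τ :=
    (hx' τ hτ).prodMk (hasDerivWithinAt_id τ _)
  rw [hderiv.derivWithin (uniqueDiffOn_Icc hab τ hτ)]
  refine ⟨fun h => one_ne_zero (congrArg Prod.snd h), ?_, zero_lt_one⟩
  rw [lorentzForm, sub_nonpos]
  exact pow_le_pow_left₀ (norm_nonneg _) (hle τ hτ) 2

theorem CausallyPrecedes.exists_isFutureCausalArc (hn : 2 ≤ n) (h : CausallyPrecedes p q)
    (hlt : p.2 < q.2) : ∃ γ, IsFutureCausalArc γ p.2 q.2 ∧ γ p.2 = p ∧ γ q.2 = q := by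
  have hrank : 1 < Module.rank ℝ (EuclideanSpace ℝ (Fin n)) := by
    exact_mod_cast Module.lt_rank_of_lt_finrank (by rwa [finrank_euclideanSpace_fin])
  obtain ⟨v, hv, hpv, hq⟩ := exists_greatCircle_angle_eq hrank p.1.norm_coe q.1.norm_coe
  have hpos : 0 < q.2 - p.2 := sub_pos.2 hlt
  set speed := roundDist p.1 q.1 / (q.2 - p.2) with hspeed
  have hspeed_le : ‖speed‖ ≤ 1 := by
    rw [Real.norm_of_nonneg (div_nonneg (roundDist_nonneg _ _) hpos.le)]
    exact (div_le_one hpos).2 h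
  let x : ℝ → UnitSph n := fun τ => ⟨greatCircle p.1.1 v (speed * (τ - p.2)),
    mem_sphere_zero_iff_norm.2 (norm_greatCircle p.1.norm_coe hv hpv _)⟩
  have hderiv (τ : ℝ) : HasDerivAt (fun τ => (x τ : EuclideanSpace ℝ (Fin n)))
      (speed • greatCircle v (-p.1.1) (speed * (τ - p.2))) τ :=
    (hasDerivAt_greatCircle p.1.1 v _).scomp τ
      (by simpa using ((hasDerivAt_id τ).sub_const p.2).const_mul speed)
  refine ⟨fun τ => (x τ, τ), isFutureCausalArc_mk_of_norm_deriv_le_one hlt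
    ((contDiff_greatCircle _ _).comp (by fun_prop)).contDiffOn
    (fun τ _ => (hderiv τ).hasDerivWithinAt) fun τ _ => ?_, ?_, ?_⟩
  · have hvp : inner ℝ v (-p.1.1) = 0 := by rw [inner_neg_right, real_inner_comm, hpv, neg_zero]
    rwa [norm_smul, norm_greatCircle hv (by rw [norm_neg, p.1.norm_coe]) hvp, mul_one]
  · refine Prod.ext (Subtype.ext ?_) rfl
    simp only [x, sub_self, mul_zero, greatCircle_zero]
  · refine Prod.ext (Subtype.ext ?_) rfl
    simp only [x, hspeed, div_mul_cancel₀ _ hpos.ne']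
    exact hq

theorem CausallyConvex.mem_of_causallyPrecedes {Ω : Set (EinUniv n)} (hn : 2 ≤ n)
    (hΩ : CausallyConvex Ω) {m : EinUniv n} (hp : p ∈ Ω) (hq : q ∈ Ω)
    (hpm : CausallyPrecedes p m) (hmq : CausallyPrecedes m q) : m ∈ Ω := by
  rcases hpm.eq_or_lt with rfl | hlt_pm
  · exact hp
  rcases hmq.eq_or_lt with rfl | hlt_mq
  · exact hq
  obtain ⟨γ₁, harc₁, hp₁, hm₁⟩ := hpm.exists_isFutureCausalArc hn hlt_pm
  obtain ⟨γ₂, harc₂, hm₂, hq₂⟩ := hmq.exists_isFutureCausalArc hn hlt_mq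
  obtain ⟨γ, hγ, heq₁, heq₂⟩ := harc₁.exists_concat harc₂ (hm₁.trans hm₂.symm)
  have hγp : γ p.2 = p := (heq₁ (left_mem_Icc.2 hlt_pm.le)).trans hp₁
  have hγm : γ m.2 = m := (heq₁ (right_mem_Icc.2 hlt_pm.le)).trans hm₁
  have hγq : γ q.2 = q := (heq₂ (right_mem_Icc.2 hlt_mq.le)).trans hq₂
  exact hγm ▸ hΩ p hp q hq γ _ _ hγ hγp hγq m.2 ⟨hlt_pm.le, hlt_mq.le⟩

theorem CausallyConvex.ordConnected_fiber {Ω : Set (EinUniv n)} (hn : 2 ≤ n)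
    (hΩ : CausallyConvex Ω) (x : UnitSph n) : (Prod.mk x ⁻¹' Ω).OrdConnected :=
  ⟨fun _ hs _ ht _ hr => hΩ.mem_of_causallyPrecedes hn hs ht
    (causallyPrecedes_mk_mk_left_iff.2 hr.1) (causallyPrecedes_mk_mk_left_iff.2 hr.2)⟩

end CausalOrder

section LipschitzFunctions

variable {n : ℕ} {f g F G : UnitSph n → EReal} {U : Set (UnitSph n)}

theorem isOneLipschitzOn_iff_epigraph_future : IsOneLipschitzOn f U ↔
    ∀ ⦃p q : EinUniv n⦄, p.1 ∈ U → q.1 ∈ U → CausallyPrecedes p q → f p.1 < p.2 → f q.1 < q.2 := by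
  refine ⟨fun hf p q hp hq hpq hlt => ?_, fun h x hx y hy => ?_⟩
  · have hle : p.2 + roundDist q.1 p.1 ≤ q.2 := by
      rw [roundDist_comm, ← le_sub_iff_add_le']
      exact hpq
    calc f q.1 ≤ f p.1 + (roundDist q.1 p.1 : ℝ) := hf _ hq _ hp
      _ < p.2 + (roundDist q.1 p.1 : ℝ) := EReal.add_lt_add_right_coe hlt _
      _ ≤ q.2 := by exact_mod_cast hle
  · by_contra! hlt
    obtain ⟨r, hr, hrx⟩ := EReal.lt_iff_exists_real_btwn.1 hlt
    have hy_lt : f y < (r - roundDist x y : ℝ) := by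
      rw [EReal.coe_sub]
      exact (EReal.lt_sub_iff_add_lt (by simp) (by simp)).2 hr
    have hprec : CausallyPrecedes (y, r - roundDist x y) (x, r) := by
      simp [CausallyPrecedes, roundDist_comm]
    exact hrx.not_gt (h hy hx hprec hy_lt)

theorem isOneLipschitzOn_iff_hypograph_past : IsOneLipschitzOn f U ↔
    ∀ ⦃p q : EinUniv n⦄, p.1 ∈ U → q.1 ∈ U → CausallyPrecedes p q → q.2 < f q.1 → p.2 < f p.1 := by
  refine ⟨fun hf p q hp hq hpq hlt => ?_, fun h x hx y hy => ?_⟩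
  · have hle : p.2 + roundDist q.1 p.1 ≤ q.2 := by
      rw [roundDist_comm, ← le_sub_iff_add_le']
      exact hpq
    by_contra! hge
    refine hlt.not_ge ?_
    calc f q.1 ≤ f p.1 + (roundDist q.1 p.1 : ℝ) := hf _ hq _ hp
      _ ≤ p.2 + (roundDist q.1 p.1 : ℝ) := by gcongr
      _ ≤ q.2 := by exact_mod_cast hle
  · by_contra! hlt
    obtain ⟨r, hr, hrx⟩ := EReal.lt_iff_exists_real_btwn.1 hlt
    have hprec : CausallyPrecedes (y, r - roundDist x y) (x, r) := by
      simp [CausallyPrecedes, roundDist_comm]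
    have hlt_y : ((r - roundDist x y : ℝ) : EReal) < f y := h hy hx hprec hrx
    rw [EReal.coe_sub] at hlt_y
    exact hr.not_gt (EReal.sub_lt_iff (by simp) (by simp) |>.1 hlt_y)

theorem IsOneLipschitzOn.continuousOn (hf : IsOneLipschitzOn f U) : ContinuousOn f U := by
  refine fun x hx => tendsto_order.2 ⟨fun l hl => ?_, fun u hu => ?_⟩
  · obtain ⟨s, hls, hsx⟩ := EReal.lt_iff_exists_real_btwn.1 hl
    obtain ⟨t, hst, htx⟩ := EReal.lt_iff_exists_real_btwn.1 hsx
    have hst : s < t := by exact_mod_cast hst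
    filter_upwards [self_mem_nhdsWithin,
      nhdsWithin_le_nhds (eventually_roundDist_lt x (sub_pos.2 hst))] with y hy hxy
    rw [roundDist_comm] at hxy
    exact hls.trans (isOneLipschitzOn_iff_hypograph_past.1 hf (p := (y, s)) (q := (x, t))
      hy hx hxy.le htx)
  · obtain ⟨t, hxt, htu⟩ := EReal.lt_iff_exists_real_btwn.1 hu
    obtain ⟨s, hxs, hst⟩ := EReal.lt_iff_exists_real_btwn.1 hxt
    have hst : s < t := by exact_mod_cast hst
    filter_upwards [self_mem_nhdsWithin,
      nhdsWithin_le_nhds (eventually_roundDist_lt x (sub_pos.2 hst))] with y hy hxy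
    exact (isOneLipschitzOn_iff_epigraph_future.1 hf (p := (x, s)) (q := (y, t))
      hx hy hxy.le hxs).trans htu

theorem IsOneLipschitzOn.exists_extension (hf : IsOneLipschitzOn f U) :
    ∃ F : UnitSph n → EReal, IsOneLipschitzOn F univ ∧ EqOn f F U := by
  refine ⟨fun x => ⨅ y ∈ U, f y + (roundDist x y : ℝ), fun x _ y _ => ?_, fun x hx => ?_⟩
  · refine (EReal.sub_le_iff_le_add (by simp) (by simp)).1 (le_iInf₂ fun z hz => ?_)
    refine EReal.sub_le_of_le_add ((iInf₂_le z hz).trans ?_)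
    rw [add_assoc, ← EReal.coe_add]
    gcongr
    linarith [roundDist_triangle x y z]
  · refine le_antisymm (le_iInf₂ fun z hz => hf x hx z hz) ((iInf₂_le x hx).trans ?_)
    simp [roundDist_self]

theorem boundaryExtensionsCoincide_iff_eqOn_frontier (hF : Continuous F) (hG : Continuous G)
    (hfF : EqOn f F U) (hgG : EqOn g G U) :
    BoundaryExtensionsCoincide f g U ↔ EqOn F G (frontier U) := by
  have hf (x) : Tendsto f (𝓝[U] x) (𝓝 (F x)) :=
    hF.continuousWithinAt.tendsto.congr' hfF.symm.eventuallyEq_nhdsWithin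
  have hg (x) : Tendsto g (𝓝[U] x) (𝓝 (G x)) :=
    hG.continuousWithinAt.tendsto.congr' hgG.symm.eventuallyEq_nhdsWithin
  refine ⟨fun h x hx => ?_, fun h x hx => ⟨F x, hf x, h hx ▸ hg x⟩⟩
  have : (𝓝[U] x).NeBot := mem_closure_iff_nhdsWithin_neBot.1 hx.1
  obtain ⟨l, hfl, hgl⟩ := h x hx
  exact (tendsto_nhds_unique (hf x) hfl).trans (tendsto_nhds_unique hgl (hg x))

end LipschitzFunctions

section RegionBetweenGraphs

variable {X : Type*} {U : Set X} {f g F G : X → EReal} {Ω : Set (X × ℝ)} {x : X} {t : ℝ}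

/-- The region of `X × ℝ` lying over `U`, strictly between the graphs of two functions with values
in `[-∞, +∞]`. -/
def regionBetweenGraphs (U : Set X) (f g : X → EReal) : Set (X × ℝ) :=
  {p | p.1 ∈ U ∧ f p.1 < p.2 ∧ p.2 < g p.1}

theorem regionBetweenGraphs_congr (hf : EqOn f F U) (hg : EqOn g G U) :
    regionBetweenGraphs U f g = regionBetweenGraphs U F G := by
  ext p
  refine and_congr_right fun hp => ?_
  rw [hf hp, hg hp]

theorem isOpen_regionBetweenGraphs [TopologicalSpace X] (hU : IsOpen U) (hf : ContinuousOn f U)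
    (hg : ContinuousOn g U) : IsOpen (regionBetweenGraphs U f g) := by
  have hmaps : MapsTo Prod.fst (Prod.fst ⁻¹' U : Set (X × ℝ)) U := fun _ hp => hp
  have htime : Continuous fun p : X × ℝ => (p.2 : EReal) :=
    continuous_coe_real_ereal.comp continuous_snd
  have hcont : ContinuousOn (fun p : X × ℝ => (f p.1, (p.2 : EReal), g p.1)) (Prod.fst ⁻¹' U) :=
    (hf.comp continuousOn_fst hmaps).prodMk
      (htime.continuousOn.prodMk (hg.comp continuousOn_fst hmaps))
  have hopen : IsOpen {z : EReal × EReal × EReal | z.1 < z.2.1 ∧ z.2.1 < z.2.2} :=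
    (isOpen_lt continuous_fst continuous_snd.fst).inter
      (isOpen_lt continuous_snd.fst continuous_snd.snd)
  exact hcont.isOpen_inter_preimage (hU.preimage continuous_fst) hopen

/-- The lower boundary of `Ω ⊆ X × ℝ`, as a function on `X`. Over a point whose fibre is empty it is
`+∞`. -/
noncomputable def lowerBoundary (Ω : Set (X × ℝ)) (x : X) : EReal :=
  ⨅ t ∈ Prod.mk x ⁻¹' Ω, ((t : ℝ) : EReal)

/-- The upper boundary of `Ω ⊆ X × ℝ`, as a function on `X`. Over a point whose fibre is empty it is
`-∞`. -/
noncomputable def upperBoundary (Ω : Set (X × ℝ)) (x : X) : EReal :=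
  ⨆ t ∈ Prod.mk x ⁻¹' Ω, ((t : ℝ) : EReal)

theorem lowerBoundary_lt_iff {r : EReal} : lowerBoundary Ω x < r ↔ ∃ t : ℝ, (x, t) ∈ Ω ∧ t < r := by
  simp only [lowerBoundary, iInf_lt_iff, exists_prop, mem_preimage]

theorem lt_upperBoundary_iff {r : EReal} : r < upperBoundary Ω x ↔ ∃ t : ℝ, (x, t) ∈ Ω ∧ r < t :=
  lt_biSup_iff

theorem lowerBoundary_lt_of_isOpen_fiber (hopen : IsOpen (Prod.mk x ⁻¹' Ω)) (ht : (x, t) ∈ Ω) :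
    lowerBoundary Ω x < t := by
  have hmem : Prod.mk x ⁻¹' Ω ∈ 𝓝[<] t := nhdsWithin_le_nhds (hopen.mem_nhds ht)
  obtain ⟨s, hs, hst⟩ := Filter.nonempty_of_mem (inter_mem hmem self_mem_nhdsWithin)
  exact lowerBoundary_lt_iff.2 ⟨s, hs, EReal.coe_lt_coe_iff.2 hst⟩

theorem lt_upperBoundary_of_isOpen_fiber (hopen : IsOpen (Prod.mk x ⁻¹' Ω)) (ht : (x, t) ∈ Ω) :
    t < upperBoundary Ω x := by
  have hmem : Prod.mk x ⁻¹' Ω ∈ 𝓝[>] t := nhdsWithin_le_nhds (hopen.mem_nhds ht)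
  obtain ⟨s, hs, hts⟩ := Filter.nonempty_of_mem (inter_mem hmem self_mem_nhdsWithin)
  exact lt_upperBoundary_iff.2 ⟨s, hs, EReal.coe_lt_coe_iff.2 hts⟩

theorem eq_regionBetweenGraphs_of_ordConnected_fiber (hopen : ∀ x, IsOpen (Prod.mk x ⁻¹' Ω))
    (hconn : ∀ x, (Prod.mk x ⁻¹' Ω).OrdConnected) :
    Ω = regionBetweenGraphs (Prod.fst '' Ω) (lowerBoundary Ω) (upperBoundary Ω) := by
  ext ⟨x, r⟩
  refine ⟨fun hr => ⟨mem_image_of_mem _ hr, lowerBoundary_lt_of_isOpen_fiber (hopen x) hr,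
    lt_upperBoundary_of_isOpen_fiber (hopen x) hr⟩, ?_⟩
  rintro ⟨-, hlower, hupper⟩
  obtain ⟨s, hs, hsr⟩ := lowerBoundary_lt_iff.1 hlower
  obtain ⟨t, ht, hrt⟩ := lt_upperBoundary_iff.1 hupper
  exact (hconn x).out hs ht ⟨(EReal.coe_lt_coe_iff.1 hsr).le, (EReal.coe_lt_coe_iff.1 hrt).le⟩

end RegionBetweenGraphs

section Characterization

variable {n : ℕ} {Ω : Set (EinUniv n)} {U : Set (UnitSph n)} {f g : UnitSph n → EReal}

theorem CausallyConvex.isOneLipschitzOn_lowerBoundary (hn : 2 ≤ n) (hΩ : CausallyConvex Ω) :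
    IsOneLipschitzOn (lowerBoundary Ω) (Prod.fst '' Ω) := by
  rw [isOneLipschitzOn_iff_epigraph_future]
  rintro ⟨x, s⟩ ⟨_, t⟩ - ⟨⟨y, u⟩, hu, rfl⟩ hprec hlower
  obtain ⟨r, hr, hrs⟩ := lowerBoundary_lt_iff.1 hlower
  have hrs : r < s := EReal.coe_lt_coe_iff.1 hrs
  refine lowerBoundary_lt_iff.2 ?_
  rcases lt_or_ge u t with hut | htu
  · exact ⟨u, hu, EReal.coe_lt_coe_iff.2 hut⟩
  · refine ⟨t - (s - r), hΩ.mem_of_causallyPrecedes hn hr hu ?_ ?_,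
      EReal.coe_lt_coe_iff.2 (by linarith)⟩
    · have : roundDist x y ≤ t - s := hprec
      change roundDist x y ≤ t - (s - r) - r
      linarith
    · exact causallyPrecedes_mk_mk_left_iff.2 (by linarith)

theorem CausallyConvex.isOneLipschitzOn_upperBoundary (hn : 2 ≤ n) (hΩ : CausallyConvex Ω) :
    IsOneLipschitzOn (upperBoundary Ω) (Prod.fst '' Ω) := by
  rw [isOneLipschitzOn_iff_hypograph_past]
  rintro ⟨_, s⟩ ⟨y, t⟩ ⟨⟨x, u⟩, hu, rfl⟩ - hprec hupper
  obtain ⟨r, hr, htr⟩ := lt_upperBoundary_iff.1 hupper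
  have htr : t < r := EReal.coe_lt_coe_iff.1 htr
  refine lt_upperBoundary_iff.2 ?_
  rcases lt_or_ge s u with hsu | hus
  · exact ⟨u, hu, EReal.coe_lt_coe_iff.2 hsu⟩
  · refine ⟨s + (r - t), hΩ.mem_of_causallyPrecedes hn hu hr ?_ ?_,
      EReal.coe_lt_coe_iff.2 (by linarith)⟩
    · exact causallyPrecedes_mk_mk_left_iff.2 (by linarith)
    · have : roundDist x y ≤ t - s := hprec
      change roundDist x y ≤ r - (s + (r - t))
      linarith

theorem CausallyConvex.eq_regionBetweenGraphs (hn : 2 ≤ n) (hopen : IsOpen Ω)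
    (hΩ : CausallyConvex Ω) :
    Ω = regionBetweenGraphs (Prod.fst '' Ω) (lowerBoundary Ω) (upperBoundary Ω) :=
  eq_regionBetweenGraphs_of_ordConnected_fiber (fun _ => hopen.preimage (by fun_prop))
    (hΩ.ordConnected_fiber hn)

theorem causallyConvex_regionBetweenGraphs (hU : IsOpen U) (hf : IsOneLipschitzOn f univ)
    (hg : IsOneLipschitzOn g univ) (hfg : EqOn f g (frontier U)) :
    CausallyConvex (regionBetweenGraphs U f g) := by
  rintro _ ⟨haU, haf, -⟩ _ ⟨-, -, hbg⟩ γ a b hγ rfl rfl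
  have habove (τ) (hτ : τ ∈ Icc a b) : f (γ τ).1 < (γ τ).2 :=
    isOneLipschitzOn_iff_epigraph_future.1 hf trivial trivial
      (hγ.causallyPrecedes le_rfl hτ.1 hτ.2) haf
  have hbelow (τ) (hτ : τ ∈ Icc a b) : (γ τ).2 < g (γ τ).1 :=
    isOneLipschitzOn_iff_hypograph_past.1 hg trivial trivial
      (hγ.causallyPrecedes hτ.1 hτ.2 le_rfl) hbg
  have hover : (fun τ => (γ τ).1) '' Icc a b ⊆ U := by
    refine (isPreconnected_Icc.image _ hγ.continuousOn.fst).subset_of_closure_inter_subset hU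
      ⟨_, mem_image_of_mem _ (left_mem_Icc.2 hγ.lt.le), haU⟩ ?_
    rintro _ ⟨hcl, τ, hτ, rfl⟩
    by_contra hnot
    have hfr : (γ τ).1 ∈ frontier U := hU.frontier_eq ▸ ⟨hcl, hnot⟩
    exact ((habove τ hτ).trans (hbelow τ hτ)).ne (hfg hfr)
  exact fun τ hτ => ⟨hover (mem_image_of_mem _ hτ), habove τ hτ, hbelow τ hτ⟩

theorem CausallyConvex.mem_of_mem_closure_of_lt (hn : 2 ≤ n) (hf : Continuous f)
    (hg : Continuous g) (hΩ : CausallyConvex (regionBetweenGraphs U f g)) {x : UnitSph n}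
    (hx : x ∈ closure U) (hfg : f x < g x) : x ∈ U := by
  obtain ⟨r, hfr, hrg⟩ := EReal.lt_iff_exists_real_btwn.1 hfg
  obtain ⟨s, hfs, hsr⟩ := EReal.lt_iff_exists_real_btwn.1 hfr
  obtain ⟨t, hrt, htg⟩ := EReal.lt_iff_exists_real_btwn.1 hrg
  have hsr' : 0 < r - s := sub_pos.2 (EReal.coe_lt_coe_iff.1 hsr)
  have hrt' : 0 < t - r := sub_pos.2 (EReal.coe_lt_coe_iff.1 hrt)
  obtain ⟨y, hyU, hys, hyt, hds, hdt⟩ := ((mem_closure_iff_frequently.1 hx).and_eventually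
    (((hf.tendsto x).eventually_lt_const hfs).and
      (((hg.tendsto x).eventually_const_lt htg).and
        ((eventually_roundDist_lt x hsr').and (eventually_roundDist_lt x hrt'))))).exists
  rw [roundDist_comm] at hds
  have hmem : (x, r) ∈ regionBetweenGraphs U f g :=
    hΩ.mem_of_causallyPrecedes hn (p := (y, s)) (q := (y, t))
      ⟨hyU, hys, (hsr.trans hrt).trans hyt⟩ ⟨hyU, hys.trans (hsr.trans hrt), hyt⟩ hds.le hdt.le
  exact hmem.1

theorem causallyConvex_regionBetweenGraphs_iff (hn : 2 ≤ n) (hU : IsOpen U)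
    (hf : IsOneLipschitzOn f U) (hg : IsOneLipschitzOn g U) (hfg : ∀ x ∈ U, f x < g x) :
    CausallyConvex (regionBetweenGraphs U f g) ↔ BoundaryExtensionsCoincide f g U := by
  obtain ⟨F, hF, hfF⟩ := hf.exists_extension
  obtain ⟨G, hG, hgG⟩ := hg.exists_extension
  have hFc : Continuous F := continuousOn_univ.1 hF.continuousOn
  have hGc : Continuous G := continuousOn_univ.1 hG.continuousOn
  rw [regionBetweenGraphs_congr hfF hgG,
    boundaryExtensionsCoincide_iff_eqOn_frontier hFc hGc hfF hgG]
  refine ⟨fun hΩ x hx => ?_, causallyConvex_regionBetweenGraphs hU hF hG⟩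
  have hle : F x ≤ G x :=
    le_on_closure (fun y hy => hfF hy ▸ hgG hy ▸ (hfg y hy).le) hFc.continuousOn hGc.continuousOn
      hx.1
  rw [hU.frontier_eq] at hx
  exact hle.eq_of_not_lt fun hlt => hx.2 (hΩ.mem_of_mem_closure_of_lt hn hFc hGc hx.1 hlt)

end Characterization

theorem mainTheorem10_general (n : ℕ) (hn : 2 ≤ n) (Ω : Set (EinUniv n)) :
    (IsOpen Ω ∧ CausallyConvex Ω) ↔
      ∃ (U : Set (UnitSph n)) (fminus fplus : UnitSph n → EReal),
        IsOpen U ∧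
        IsOneLipschitzOn fminus U ∧
        IsOneLipschitzOn fplus U ∧
        (∀ x ∈ U, fminus x < fplus x) ∧
        BoundaryExtensionsCoincide fminus fplus U ∧
        Ω = {p : EinUniv n | p.1 ∈ U ∧ fminus p.1 < (p.2 : EReal) ∧ (p.2 : EReal) < fplus p.1} := by
  constructor
  · rintro ⟨hopen, hΩ⟩
    have hU : IsOpen (Prod.fst '' Ω) := isOpenMap_fst _ hopen
    have hlower := hΩ.isOneLipschitzOn_lowerBoundary hn
    have hupper := hΩ.isOneLipschitzOn_upperBoundary hn
    have heq := hΩ.eq_regionBetweenGraphs hn hopen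
    have hlt : ∀ x ∈ Prod.fst '' Ω, lowerBoundary Ω x < upperBoundary Ω x := by
      rintro _ ⟨p, hp, rfl⟩
      obtain ⟨-, hl, hu⟩ := heq.subset hp
      exact hl.trans hu
    exact ⟨_, _, _, hU, hlower, hupper, hlt,
      (causallyConvex_regionBetweenGraphs_iff hn hU hlower hupper hlt).1 (heq ▸ hΩ), heq⟩
  · rintro ⟨U, f, g, hU, hf, hg, hlt, hboundary, rfl⟩
    exact ⟨isOpen_regionBetweenGraphs hU hf.continuousOn hg.continuousOn,
      (causallyConvex_regionBetweenGraphs_iff hn hU hf hg hlt).2 hboundary⟩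

theorem mainTheorem10 (n : ℕ) (hn : 3 ≤ n) (Ω : Set (EinUniv n)) :
    (IsOpen Ω ∧ CausallyConvex Ω) ↔
      ∃ (U : Set (UnitSph n)) (fminus fplus : UnitSph n → EReal),
        IsOpen U ∧
        IsOneLipschitzOn fminus U ∧
        IsOneLipschitzOn fplus U ∧
        (∀ x ∈ U, fminus x < fplus x) ∧
        BoundaryExtensionsCoincide fminus fplus U ∧
        Ω = {p : EinUniv n | p.1 ∈ U ∧ fminus p.1 < (p.2 : EReal) ∧ (p.2 : EReal) < fplus p.1} :=
  mainTheorem10_general n (Nat.le_of_succ_le hn) Ω
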